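/- **Theorem 1 (Outage Theorem).** Let $\delta\in\{\mathrm{HD},\mathrm{FD}\}$ be the operation mode (half duplex or full duplex) of an inband-overlay D2D network, and put $\mathbb 1_{\mathrm{FD}}=1$, $\mathbb 1_{\mathrm{HD}}=0$. Let $\lambda\ge 0$ be the density of the users, $\mu\in[0,1]$ the fraction of demanding users, $\mathcal P_\delta\in[0,1]$ the probability that a user operates in mode $\delta$, $\rho_d>0$ the transmit power, $\alpha>2$ the path-loss exponent, $R_d>0$ the distance from the typical receiver to its transmitter, $\sigma^2\ge 0$ the noise power, $\beta\in[0,1]$ the residual self-interference-to-power ratio and $\theta_d>0$ the SINR threshold. Let the interferers form a homogeneous Poisson point process $\Phi_\delta=\{z_i\}$ on $\mathbb R^2$ of intensity $\mu\mathcal P_\delta\lambda$, let the fading gains $h$ (desired link) and $h_i$ (link from $z_i$) be independent, exponentially distributed with mean $1$, and independent of $\Phi_\delta$. At the typical receiver, located at the origin, let $$\mathcal I_{d,\delta}=\sum_{z_i\in\Phi_\delta}\rho_d h_i\|z_i\|^{-\alpha},\qquad \Upsilon^\delta=\frac{\rho_d\,h\,R_d^{-\alpha}}{\sigma^2+\mathcal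 I_{d,\delta}+\mathbb 1_\delta\,\beta\rho_d}$$ (with value $\infty$ where the numerator is positive and the denominator is $0$), and let $\mathcal L_{\mathcal I_{d,\delta}}(s)=\mathbb E[e^{-s\mathcal I_{d,\delta}}]$. Then $\mathcal I_{d,\delta}<\infty$ almost surely, and the outage probability is $$\mathbb P(\Upsilon^\delta\le\theta_d)=1-\exp\!\left(-\frac{\theta_dR_d^\alpha(\sigma^2+\mathbb 1_\delta\beta\rho_d)}{\rho_d}\right)\mathcal L_{\mathcal I_{d,\delta}}\!\left(\frac{\theta_dR_d^\alpha}{\rho_d}\right),$$ where, for all $s\ge 0$, $$\mathcal L_{\mathcal I_{d,\delta}}(s)=\exp\!\left(-\frac{2\pi^2}{\alpha}\,\mu\mathcal P_\delta\lambda\,(s\rho_d)^{2/\alpha}\csc\!\left(\frac{2\pi}{\alpha}\right)\right).$$ -/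

import Mathlib

open MeasureTheory ProbabilityTheory
open scoped ENNReal NNReal

/-- The Euclidean plane in which the devices are located; the typical receiver is at the origin. -/
abbrev Plane : Type := EuclideanSpace ℝ (Fin 2)

/-- Operation mode of the D2D network: half duplex or full duplex. -/
inductive D2DMode : Type
  | HD
  | FD

/-- The indicator of full-duplex operation: `1` for `FD` and `0` for `HD`. -/
def D2DMode.indicator : D2DMode → ℝ
  | .HD => 0
  | .FD => 1

/-- A point process is given by its total number of points `K` (possibly infinite) together with
an enumeration `Z 0, Z 1, …` of them, of which only the `Z i` with `i < K` are points.
`pointCount K Z B ω` is the number of points in `B`, counted with multiplicity. -/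
noncomputable def pointCount {Ω E : Type*} (K : Ω → ℕ∞) (Z : ℕ → Ω → E) (B : Set E) (ω : Ω) :
    ℕ∞ :=
  Set.encard {i : ℕ | (i : ℕ∞) < K ω ∧ Z i ω ∈ B}

/-- The point process `(K, Z)` is a Poisson point process with intensity measure `Λ`: the number of
points in a measurable set of finite intensity is Poisson distributed with parameter its
intensity, and the numbers of points in pairwise disjoint measurable sets are independent. -/
structure IsPoissonPointProcess {Ω E : Type*} [MeasurableSpace Ω] [MeasurableSpace E]
    (P : Measure Ω) (K : Ω → ℕ∞) (Z : ℕ → Ω → E) (Λ : Measure E) : Prop where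
  measurable_number : Measurable K
  measurable_point : ∀ i, Measurable (Z i)
  poisson_count : ∀ B : Set E, MeasurableSet B → Λ B ≠ ∞ →
    HasLaw (pointCount K Z B)
      ((poissonMeasure (Λ B).toNNReal).map (fun n : ℕ => (n : ℕ∞))) P
  indep_count : ∀ (n : ℕ) (B : Fin n → Set E), (∀ j, MeasurableSet (B j)) →
    (Pairwise fun j k => Disjoint (B j) (B k)) →
    iIndepFun (fun j => pointCount K Z (B j)) P

/-- The interference `∑ ρ hᵢ ‖zᵢ‖^(-α)` at the origin, the sum being over the points of the process
`(K, Z)`, with transmit power `ρ`, fading gain `h i` on the link from the `i`-th point, and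
path-loss exponent `α`. It is a sum of nonnegative terms, with values in `[0, ∞]`. -/
noncomputable def interference {Ω : Type*} (ρ α : ℝ) (K : Ω → ℕ∞) (Z : ℕ → Ω → Plane)
    (h : ℕ → Ω → ℝ) (ω : Ω) : ℝ≥0∞ :=
  ∑' i : {i : ℕ // (i : ℕ∞) < K ω},
    ENNReal.ofReal (ρ * h i ω) * ‖Z i ω‖ₑ ^ (-α)

/-- The signal-to-interference-plus-noise ratio
`ρ g R^(-α) / (σ² + I + 1_δ β ρ)` at the typical receiver, where `g` is the fading gain of the
desired link, `R` its length, `I` the interference, `σ ^ 2` the noise power and `β` the residual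
self-interference-to-power ratio. It has values in `[0, ∞]`. -/
noncomputable def sinr {Ω : Type*} (δ : D2DMode) (ρ α R σ β : ℝ) (g : Ω → ℝ) (I : Ω → ℝ≥0∞)
    (ω : Ω) : ℝ≥0∞ :=
  ENNReal.ofReal (ρ * g ω * R ^ (-α)) /
    (ENNReal.ofReal (σ ^ 2) + I ω + ENNReal.ofReal (δ.indicator * (β * ρ)))

/-- The Laplace transform `s ↦ E[exp (-s X)]` of a random variable `X ≥ 0` that is almost surely
finite. -/
noncomputable def laplaceTransform {Ω : Type*} [MeasurableSpace Ω] (P : Measure Ω)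
    (X : Ω → ℝ≥0∞) (s : ℝ) : ℝ :=
  ∫ ω, Real.exp (-s * (X ω).toReal) ∂P

open Filter Topology

/-! Success means that the desired gain exceeds a threshold affine in the interference. Given the
interference, the exponential tail of the gain is `negExp` of that threshold; averaging splits off
the noise factor and leaves a Laplace transform (`measure_setOf_lt_ofReal_interference`). Given the
points, integrating out the interfering gains yields the product of `(1 + s ρ ‖z‖^(-α))⁻¹` over the
points. This is `negExp` of a sum of logarithms, so the Laplace functional
(`lintegral_negExp_lintegral`) applies, and `lintegral_one_sub_inv_one_add_pathloss` evaluates the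
exponent. Working in `[0, ∞]` with `negExp ∞ = 0` makes this valid before finiteness is known;
finiteness then follows from the limit `s → 0`. -/

/-! ### The exponential on the extended half-line -/

/-- The function `x ↦ exp (-x)` on `[0, ∞]`, with `exp (-∞) = 0`. -/
noncomputable def negExp (x : ℝ≥0∞) : ℝ≥0∞ := EReal.exp (-(x : EReal))

lemma continuous_negExp : Continuous negExp :=
  ENNReal.continuous_exp.comp (continuous_neg.comp continuous_coe_ennreal_ereal)

lemma measurable_negExp : Measurable negExp := continuous_negExp.measurable

lemma antitone_negExp : Antitone negExp := fun x y hxy =>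
  EReal.exp_monotone (EReal.neg_le_neg_iff.2 (by exact_mod_cast hxy))

@[simp] lemma negExp_zero : negExp 0 = 1 := by simp [negExp]

@[simp] lemma negExp_top : negExp ∞ = 0 := by simp [negExp]

lemma negExp_le_one (x : ℝ≥0∞) : negExp x ≤ 1 := by
  simpa using antitone_negExp (zero_le : 0 ≤ x)

lemma negExp_ne_top (x : ℝ≥0∞) : negExp x ≠ ∞ := ne_top_of_le_ne_top ENNReal.one_ne_top (negExp_le_one x)

lemma negExp_ofReal {x : ℝ} (hx : 0 ≤ x) : negExp (ENNReal.ofReal x) = ENNReal.ofReal (Real.exp (-x)) := by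
  rw [negExp, EReal.coe_ennreal_ofReal, max_eq_left hx, ← EReal.coe_neg, EReal.exp_coe]

lemma negExp_of_ne_top {x : ℝ≥0∞} (hx : x ≠ ∞) :
    negExp x = ENNReal.ofReal (Real.exp (-x.toReal)) := by
  rw [← negExp_ofReal ENNReal.toReal_nonneg, ENNReal.ofReal_toReal hx]

lemma negExp_add (x y : ℝ≥0∞) : negExp (x + y) = negExp x * negExp y := by
  rw [negExp, EReal.coe_ennreal_add, EReal.neg_add (by simp) (by simp), sub_eq_add_neg, EReal.exp_add,
    negExp, negExp]

lemma negExp_sum {ι : Type*} (s : Finset ι) (f : ι → ℝ≥0∞) :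
    negExp (∑ i ∈ s, f i) = ∏ i ∈ s, negExp (f i) := by
  classical
  induction s using Finset.induction_on with
  | empty => simp
  | insert a s ha ih => rw [Finset.sum_insert ha, Finset.prod_insert ha, negExp_add, ih]

lemma negExp_toENNReal_log {x : ℝ≥0∞} (hx : 1 ≤ x) : negExp (ENNReal.log x).toENNReal = x⁻¹ := by
  have h : 0 ≤ ENNReal.log x := by simpa using ENNReal.log_monotone hx
  rw [negExp, EReal.coe_toENNReal h, EReal.exp_neg, ENNReal.exp_log]

lemma tendsto_negExp_tsum (f : ℕ → ℝ≥0∞) :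
    Tendsto (fun n => ∏ i ∈ Finset.range n, negExp (f i)) atTop (𝓝 (negExp (∑' i, f i))) := by
  simp_rw [← negExp_sum]
  exact (continuous_negExp.tendsto _).comp (ENNReal.tendsto_nat_tsum f)

/-! ### Transforms of the exponential and Poisson laws -/

lemma lintegral_exp_neg_mul_Ioi {b : ℝ} (hb : 0 < b) (a : ℝ) :
    ∫⁻ x in Set.Ioi a, ENNReal.ofReal (Real.exp (-b * x)) = ENNReal.ofReal (Real.exp (-b * a) / b) := by
  rw [← ofReal_integral_eq_lintegral_ofReal (integrableOn_exp_mul_Ioi (by linarith) a)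
    (ae_of_all _ fun x => (Real.exp_pos _).le), integral_exp_mul_Ioi (by linarith) a, neg_div_neg_eq]

lemma expMeasure_one_eq :
    expMeasure 1 = (volume.restrict (Set.Ioi (0 : ℝ))).withDensity
      (fun x => ENNReal.ofReal (Real.exp (-x))) := by
  rw [restrict_Ioi_eq_restrict_Ici, ← withDensity_indicator measurableSet_Ici]
  change volume.withDensity (exponentialPDF 1) = _
  congr 1
  ext x
  rw [exponentialPDF_eq]
  by_cases hx : 0 ≤ x <;> simp [hx]

lemma lintegral_expMeasure_negExp_mul (c : ℝ≥0∞) :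
    ∫⁻ x, negExp (ENNReal.ofReal x * c) ∂expMeasure 1 = (1 + c)⁻¹ := by
  rw [expMeasure_one_eq, lintegral_withDensity_eq_lintegral_mul _ (by fun_prop)
    (show Measurable fun x : ℝ => negExp (ENNReal.ofReal x * c) from
      measurable_negExp.comp (by fun_prop))]
  -- An interferer at the origin has infinite `c`. The integrand then vanishes for `x > 0` but not
  -- at `0`, where `0 * ∞ = 0`; hence the density over the open half-line.
  by_cases hc : c = ∞
  · subst hc
    rw [setLIntegral_congr_fun (g := fun _ => 0) measurableSet_Ioi]
    · simp
    · intro x hx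
      simp [ENNReal.mul_top (ENNReal.ofReal_pos.2 hx).ne']
  lift c to ℝ≥0 using hc
  have hc : (0 : ℝ) < 1 + c := by positivity
  rw [setLIntegral_congr_fun (g := fun x => ENNReal.ofReal (Real.exp (-(1 + c) * x)))
    measurableSet_Ioi, lintegral_exp_neg_mul_Ioi hc]
  · rw [mul_zero, Real.exp_zero, one_div, ENNReal.ofReal_inv_of_pos hc,
      ENNReal.ofReal_add zero_le_one c.coe_nonneg]
    simp
  · intro x hx
    have hx : 0 < x := hx
    simp only [Pi.mul_apply]
    rw [← ENNReal.ofReal_coe_nnreal, ← ENNReal.ofReal_mul hx.le, negExp_ofReal (by positivity),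
      ← ENNReal.ofReal_mul (Real.exp_pos _).le, ← Real.exp_add]
    ring_nf

lemma expMeasure_setOf_lt_ofReal (x : ℝ≥0∞) :
    expMeasure 1 {y | x < ENNReal.ofReal y} = negExp x := by
  by_cases hx : x = ∞
  · simp [hx]
  lift x to ℝ≥0 using hx
  have : {y : ℝ | (x : ℝ≥0∞) < ENNReal.ofReal y} = Set.Ioi (x : ℝ) := by
    ext y
    simp [ENNReal.lt_ofReal_iff_toReal_lt]
  rw [this, expMeasure_one_eq, withDensity_apply _ measurableSet_Ioi,
    Measure.restrict_restrict measurableSet_Ioi, Set.Ioi_inter_Ioi, max_eq_left x.coe_nonneg]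
  have := lintegral_exp_neg_mul_Ioi one_pos (x : ℝ)
  simp only [neg_mul, one_mul, div_one] at this
  rw [this, negExp_of_ne_top (by simp)]
  simp

/-- This is the Poisson generating function at `q = negExp c`, summed by the exponential series; `c
= ∞` is the case `q = 0`. -/
lemma lintegral_negExp_poissonMeasure (c : ℝ≥0∞) (r : ℝ≥0) :
    ∫⁻ n, negExp (c * (n : ℝ≥0∞)) ∂poissonMeasure r = negExp (r * (1 - negExp c)) := by
  obtain ⟨q, hq⟩ : ∃ q : ℝ≥0, negExp c = q := ⟨_, (ENNReal.coe_toNNReal (negExp_ne_top c)).symm⟩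
  have hq1 : (q : ℝ) ≤ 1 := by
    have := negExp_le_one c
    rw [hq] at this
    exact_mod_cast this
  have hpow (n : ℕ) : negExp (c * n) = ENNReal.ofReal ((q : ℝ) ^ n) := by
    have := negExp_sum (Finset.range n) (fun _ => c)
    simp only [Finset.sum_const, Finset.card_range, nsmul_eq_mul, Finset.prod_const, hq] at this
    rw [mul_comm, this, ENNReal.ofReal_pow q.coe_nonneg, ENNReal.ofReal_coe_nnreal]
  rw [poissonMeasure, lintegral_sum_measure]
  simp_rw [lintegral_smul_measure, lintegral_dirac, hpow, smul_eq_mul]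
  have hs : HasSum (fun n : ℕ => Real.exp (-r) * r ^ n / n.factorial * (q : ℝ) ^ n)
      (Real.exp (-(r * (1 - q)))) := by
    have := (NormedSpace.expSeries_div_hasSum_exp ((r : ℝ) * q)).mul_left (Real.exp (-r))
    rw [← Real.exp_eq_exp_ℝ, ← Real.exp_add] at this
    refine (funext fun n => ?_ : (fun n : ℕ => Real.exp (-r) * r ^ n / n.factorial * (q : ℝ) ^ n) =
      fun n => Real.exp (-r) * ((r * q : ℝ) ^ n / n.factorial)) ▸
      (by ring : -(r : ℝ) + r * q = -(r * (1 - q))) ▸ this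
    rw [mul_pow]
    ring
  have h1 : ((1 : ℝ≥0∞) - q) = ENNReal.ofReal (1 - q) := by
    rw [ENNReal.ofReal_sub _ q.coe_nonneg]; simp
  rw [hq, h1, ← ENNReal.ofReal_coe_nnreal, ← ENNReal.ofReal_mul r.coe_nonneg,
    negExp_ofReal (mul_nonneg r.coe_nonneg (by linarith)), ← hs.tsum_eq,
    ENNReal.ofReal_tsum_of_nonneg (fun n => by positivity) hs.summable]
  exact tsum_congr fun n => (ENNReal.ofReal_mul (by positivity)).symm

/-! ### The planar path-loss integral -/

lemma lintegral_exp_neg_mul_norm_rpow {p b : ℝ} (hp : 1 ≤ p) (hb : 0 < b) :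
    ∫⁻ z : Plane, ENNReal.ofReal (Real.exp (-b * ‖z‖ ^ p)) =
      ENNReal.ofReal (Real.pi * b ^ (-2 / p) * Real.Gamma (2 / p + 1)) := by
  have hp' : 0 < p := by linarith
  have hI := Complex.integral_exp_neg_mul_rpow hp hb
  have hpos : 0 < Real.pi * b ^ (-2 / p) * Real.Gamma (2 / p + 1) := by
    have := Real.Gamma_pos_of_pos (show 0 < 2 / p + 1 by positivity)
    positivity
  -- A nonzero Bochner integral certifies integrability.
  have hint : Integrable fun z : ℂ => Real.exp (-b * ‖z‖ ^ p) :=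
    Integrable.of_integral_ne_zero (by rw [hI]; exact hpos.ne')
  have hmp := (Complex.orthonormalBasisOneI.measurePreserving_repr)
  rw [← hI, ofReal_integral_eq_lintegral_ofReal hint (ae_of_all _ fun _ => (Real.exp_pos _).le),
    ← hmp.lintegral_comp (by fun_prop)]
  simp

/-- For `A > 0` and `z ≠ 0` the integrand is `A / (A + ‖z‖^α) = ∫ A exp (-t (A + ‖z‖^α)) dt` over `t
> 0`. By Tonelli the plane contributes `π t^(-2/α) Γ(1 + 2/α)`, and the remaining integral in `t`
gives `Γ(1 - 2/α)`, where `α > 2` is needed. Euler's reflection formula produces the cosecant. -/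
lemma lintegral_one_sub_inv_one_add_pathloss {A α : ℝ} (hA : 0 ≤ A) (hα : 2 < α) :
    ∫⁻ z : Plane, (1 - (1 + ENNReal.ofReal A * ‖z‖ₑ ^ (-α))⁻¹) =
      ENNReal.ofReal (2 * Real.pi ^ 2 / α * A ^ (2 / α) * (1 / Real.sin (2 / α * Real.pi))) := by
  have hα0 : 0 < α := by linarith
  rcases hA.eq_or_lt with rfl | hA
  · simp [Real.zero_rpow (show 2 / α ≠ 0 by positivity)]
  have h2 : 2 / α < 1 := by rw [div_lt_one hα0]; exact hα
  have hpt : ∀ᵐ z : Plane, 1 - (1 + ENNReal.ofReal A * ‖z‖ₑ ^ (-α))⁻¹ =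
      ∫⁻ t in Set.Ioi (0 : ℝ), ENNReal.ofReal (A * Real.exp (-t * A)) *
        ENNReal.ofReal (Real.exp (-t * ‖z‖ ^ α)) := by
    filter_upwards [Measure.ae_ne volume (0 : Plane)] with z hz
    have hz : 0 < ‖z‖ := norm_pos_iff.2 hz
    have hzα : 0 < ‖z‖ ^ α := by positivity
    have hrhs : ∀ t : ℝ, ENNReal.ofReal (A * Real.exp (-t * A)) *
        ENNReal.ofReal (Real.exp (-t * ‖z‖ ^ α)) =
        ENNReal.ofReal A * ENNReal.ofReal (Real.exp (-(A + ‖z‖ ^ α) * t)) := fun t => by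
      rw [← ENNReal.ofReal_mul (by positivity), ← ENNReal.ofReal_mul hA.le, mul_assoc,
        ← Real.exp_add]
      ring_nf
    simp_rw [hrhs]
    rw [lintegral_const_mul _ (by fun_prop), lintegral_exp_neg_mul_Ioi (by positivity),
      ← ofReal_norm, ENNReal.ofReal_rpow_of_pos hz, ← ENNReal.ofReal_mul hA.le,
      ← ENNReal.ofReal_one, ← ENNReal.ofReal_add zero_le_one (by positivity),
      ← ENNReal.ofReal_inv_of_pos (by positivity), ← ENNReal.ofReal_sub _ (by positivity),
      ← ENNReal.ofReal_mul hA.le, Real.rpow_neg hz.le]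
    congr 1
    rw [mul_zero, Real.exp_zero]
    field_simp
    ring
  rw [lintegral_congr_ae hpt, lintegral_lintegral_swap (by fun_prop)]
  have hin : ∀ t ∈ Set.Ioi (0 : ℝ), ∫⁻ z : Plane, ENNReal.ofReal (A * Real.exp (-t * A)) *
        ENNReal.ofReal (Real.exp (-t * ‖z‖ ^ α)) =
      ENNReal.ofReal (Real.pi * A * Real.Gamma (2 / α + 1) *
        (t ^ ((1 - 2 / α) - 1) * Real.exp (-(A * t)))) := fun t ht => by
    rw [lintegral_const_mul _ (by fun_prop), lintegral_exp_neg_mul_norm_rpow (by linarith) ht,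
      ← ENNReal.ofReal_mul (by positivity)]
    congr 1
    ring_nf
  have hG : 0 < Real.Gamma (2 / α) := Real.Gamma_pos_of_pos (by positivity)
  have hG' : 0 < Real.Gamma (1 - 2 / α) := Real.Gamma_pos_of_pos (by linarith)
  have hI := Real.integral_rpow_mul_exp_neg_mul_Ioi (a := 1 - 2 / α) (by linarith) hA
  have hval : 0 < (1 / A) ^ (1 - 2 / α) * Real.Gamma (1 - 2 / α) := by positivity
  have hint : IntegrableOn (fun t : ℝ => t ^ ((1 - 2 / α) - 1) * Real.exp (-(A * t)))
      (Set.Ioi 0) := Integrable.of_integral_ne_zero (by rw [hI]; exact hval.ne')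
  have hnn : 0 ≤ Real.pi * A * Real.Gamma (2 / α + 1) := by
    have := Real.Gamma_pos_of_pos (show 0 < 2 / α + 1 by positivity)
    positivity
  rw [setLIntegral_congr_fun measurableSet_Ioi hin]
  simp_rw [ENNReal.ofReal_mul hnn]
  rw [lintegral_const_mul _ (by fun_prop),
    ← ofReal_integral_eq_lintegral_ofReal hint, hI, ← ENNReal.ofReal_mul hnn]
  · congr 1
    have hrefl := Real.Gamma_mul_Gamma_one_sub (2 / α)
    have hApow : A * (1 / A) ^ (1 - 2 / α) = A ^ (2 / α) := by
      rw [one_div, Real.inv_rpow hA.le, ← Real.rpow_neg hA.le]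
      nth_rewrite 1 [← Real.rpow_one A]
      rw [← Real.rpow_add hA]
      ring_nf
    rw [Real.Gamma_add_one (by positivity)]
    calc _ = Real.pi * (2 / α) * (A * (1 / A) ^ (1 - 2 / α)) *
          (Real.Gamma (2 / α) * Real.Gamma (1 - 2 / α)) := by ring
      _ = _ := by rw [hApow, hrefl, mul_comm Real.pi (2 / α)]; ring_nf
  · filter_upwards [ae_restrict_mem measurableSet_Ioi] with t ht
    have ht : 0 < t := ht
    positivity

/-! ### The Laplace functional of a Poisson process -/

section PointMeasure

variable {Ω E : Type*} [MeasurableSpace E]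

/-- The counting measure of the points `z i` with `i < k`. -/
noncomputable def pointMeasure (k : ℕ∞) (z : ℕ → E) : Measure E :=
  Measure.sum fun i : {i : ℕ // (i : ℕ∞) < k} => Measure.dirac (z i)

lemma lintegral_pointMeasure (k : ℕ∞) (z : ℕ → E) {f : E → ℝ≥0∞} (hf : Measurable f) :
    ∫⁻ x, f x ∂pointMeasure k z = ∑' i : {i : ℕ // (i : ℕ∞) < k}, f (z i) := by
  simp_rw [pointMeasure, lintegral_sum_measure, lintegral_dirac' _ hf]

lemma tsum_lt_eq_tsum_ite (k : ℕ∞) (g : ℕ → ℝ≥0∞) :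
    ∑' i : {i : ℕ // (i : ℕ∞) < k}, g i = ∑' i : ℕ, if (i : ℕ∞) < k then g i else 0 :=
  (tsum_subtype {i : ℕ | (i : ℕ∞) < k} g).trans <| tsum_congr fun i => by
    by_cases h : (i : ℕ∞) < k <;> simp [h]

lemma pointMeasure_apply (K : Ω → ℕ∞) (Z : ℕ → Ω → E) {B : Set E} (hB : MeasurableSet B) (ω : Ω) :
    pointMeasure (K ω) (fun i => Z i ω) B = (pointCount K Z B ω : ℝ≥0∞) := by
  rw [← lintegral_indicator_one hB, lintegral_pointMeasure _ _ (measurable_one.indicator hB),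
    pointCount, ← ENNReal.tsum_set_one, tsum_subtype _ (fun _ => (1 : ℝ≥0∞)),
    tsum_lt_eq_tsum_ite _ (fun i => B.indicator 1 (Z i ω))]
  refine tsum_congr fun i => ?_
  by_cases h1 : (i : ℕ∞) < K ω <;> by_cases h2 : Z i ω ∈ B <;> simp [h1, h2]

variable [MeasurableSpace Ω]

lemma measurable_tsum_lt {g : ℕ → Ω → ℝ≥0∞} (hg : ∀ i, Measurable (g i)) {K : Ω → ℕ∞}
    (hK : Measurable K) : Measurable fun ω => ∑' i : {i : ℕ // (i : ℕ∞) < K ω}, g i ω := by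
  simp_rw [fun ω => tsum_lt_eq_tsum_ite (K ω) (fun i => g i ω)]
  exact Measurable.tsum fun i => Measurable.ite
    (hK (MeasurableSet.of_discrete (s := Set.Ioi (i : ℕ∞)))) (hg i) measurable_const

lemma measurable_lintegral_pointMeasure {K : Ω → ℕ∞} {Z : ℕ → Ω → E} (hK : Measurable K)
    (hZ : ∀ i, Measurable (Z i)) {f : E → ℝ≥0∞} (hf : Measurable f) :
    Measurable fun ω => ∫⁻ x, f x ∂pointMeasure (K ω) (fun i => Z i ω) := by
  simp_rw [lintegral_pointMeasure _ _ hf]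
  exact measurable_tsum_lt (fun i => hf.comp (hZ i)) hK

namespace IsPoissonPointProcess

variable {P : Measure Ω} [IsProbabilityMeasure P] {K : Ω → ℕ∞} {Z : ℕ → Ω → E} {Λ : Measure E}

/-- The zero fibre of a simple function may have infinite intensity, where no law of the count is
prescribed; with `c = 0` both sides are `1`. -/
lemma lintegral_negExp_mul_pointCount (hZ : IsPoissonPointProcess P K Z Λ) {B : Set E}
    (hB : MeasurableSet B) (c : ℝ≥0∞) (hc : c = 0 ∨ Λ B ≠ ∞) :
    ∫⁻ ω, negExp (c * (pointCount K Z B ω : ℝ≥0∞)) ∂P = negExp ((1 - negExp c) * Λ B) := by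
  rcases hc with rfl | hc
  · simp
  have hlaw := hZ.poisson_count B hB hc
  have hm : Measurable fun n : ℕ∞ => negExp (c * (n : ℝ≥0∞)) := .of_discrete
  rw [← lintegral_map' hm.aemeasurable hlaw.aemeasurable, hlaw.map_eq,
    lintegral_map hm .of_discrete]
  simp_rw [ENat.toENNReal_coe]
  rw [lintegral_negExp_poissonMeasure, ENNReal.coe_toNNReal hc, mul_comm]

/-- The fibres of `F` are disjoint, so their counts are independent and the expectation factors over
the values of `F`. -/
lemma lintegral_negExp_simpleFunc (hZ : IsPoissonPointProcess P K Z Λ) (F : SimpleFunc E ℝ≥0∞)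
    (hF : ∀ c, c ≠ 0 → Λ (F ⁻¹' {c}) ≠ ∞) :
    ∫⁻ ω, negExp (∫⁻ x, F x ∂pointMeasure (K ω) (fun i => Z i ω)) ∂P =
      negExp (∫⁻ x, (1 - negExp (F x)) ∂Λ) := by
  have hB (c : ℝ≥0∞) : MeasurableSet (F ⁻¹' {c}) := F.measurableSet_fiber c
  have hR : ∫⁻ x, (1 - negExp (F x)) ∂Λ = ∑ c ∈ F.range, (1 - negExp c) * Λ (F ⁻¹' {c}) := by
    rw [← F.map_lintegral (fun c => 1 - negExp c), ← SimpleFunc.lintegral_eq_lintegral]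
    rfl
  have hL (ω : Ω) : negExp (∫⁻ x, F x ∂pointMeasure (K ω) (fun i => Z i ω)) =
      ∏ j : Fin F.range.card, negExp ((F.range.equivFin.symm j : ℝ≥0∞) *
        (pointCount K Z (F ⁻¹' {(F.range.equivFin.symm j : ℝ≥0∞)}) ω : ℝ≥0∞)) := by
    rw [SimpleFunc.lintegral_eq_lintegral, SimpleFunc.lintegral, negExp_sum]
    simp_rw [pointMeasure_apply K Z (hB _)]
    rw [← Finset.prod_coe_sort F.range, ← Equiv.prod_comp F.range.equivFin.symm]
  have hm (c : ℝ≥0∞) : Measurable fun n : ℕ∞ => negExp (c * (n : ℝ≥0∞)) := .of_discrete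
  have hmN (c : ℝ≥0∞) : Measurable fun ω => negExp (c * (pointCount K Z (F ⁻¹' {c}) ω : ℝ≥0∞)) := by
    simp_rw [← pointMeasure_apply K Z (hB c), ← lintegral_indicator_one (hB c)]
    exact measurable_negExp.comp ((measurable_lintegral_pointMeasure hZ.measurable_number
      hZ.measurable_point (measurable_one.indicator (hB c))).const_mul c)
  have hind := (hZ.indep_count _ (fun j => F ⁻¹' {(F.range.equivFin.symm j : ℝ≥0∞)})
    (fun j => hB _) (fun j k hjk => Disjoint.preimage _ (by
      simpa using fun h => hjk (F.range.equivFin.symm.injective (Subtype.ext h))))).comp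
    (fun j n => negExp ((F.range.equivFin.symm j : ℝ≥0∞) * (n : ℝ≥0∞))) (fun j => hm _)
  simp_rw [hL]
  have := lintegral_prod_eq_prod_lintegral_of_indepFun Finset.univ _ hind
    (fun j => hmN _)
  simp only [Function.comp_def] at this
  rw [this, hR, negExp_sum, ← Finset.prod_coe_sort F.range, ← Equiv.prod_comp F.range.equivFin.symm]
  refine Finset.prod_congr rfl fun j _ => hZ.lintegral_negExp_mul_pointCount (hB _) _ ?_
  by_cases h : (F.range.equivFin.symm j : ℝ≥0∞) = 0
  · exact Or.inl h
  · exact Or.inr (hF _ h)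

/-- The Laplace functional of a Poisson point process. -/
theorem lintegral_negExp_lintegral [SigmaFinite Λ] (hZ : IsPoissonPointProcess P K Z Λ)
    {f : E → ℝ≥0∞} (hf : Measurable f) :
    ∫⁻ ω, negExp (∫⁻ x, f x ∂pointMeasure (K ω) (fun i => Z i ω)) ∂P =
      negExp (∫⁻ x, (1 - negExp (f x)) ∂Λ) := by
  -- Cutting off to sets of finite intensity makes the nonzero fibres finite. Monotone convergence
  -- then handles the inner integrals, dominated convergence the expectation.
  let F (n : ℕ) : SimpleFunc E ℝ≥0∞ := (SimpleFunc.eapprox f n).restrict (spanningSets Λ n)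
  have hFapp (n : ℕ) (x : E) :
      F n x = (spanningSets Λ n).indicator (SimpleFunc.eapprox f n) x :=
    SimpleFunc.restrict_apply _ (measurableSet_spanningSets Λ n) x
  have hFmono (x : E) : Monotone fun n => F n x := fun m n hmn => by
    simp only [hFapp]
    exact (Set.indicator_le_indicator_of_subset (monotone_spanningSets Λ hmn)
      (fun _ => zero_le) x).trans (Set.indicator_le_indicator (SimpleFunc.monotone_eapprox f hmn x))
  have hFlim (x : E) : Tendsto (fun n => F n x) atTop (𝓝 (f x)) := by
    have h := tendsto_atTop_iSup fun m n (hmn : m ≤ n) => SimpleFunc.monotone_eapprox f hmn x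
    rw [SimpleFunc.iSup_eapprox_apply hf] at h
    refine h.congr' ?_
    filter_upwards [eventually_mem_spanningSets Λ x] with n hn
    rw [hFapp, Set.indicator_of_mem hn]
  have hFin (n : ℕ) (c : ℝ≥0∞) (hc : c ≠ 0) : Λ (F n ⁻¹' {c}) ≠ ∞ := by
    refine ne_top_of_le_ne_top (measure_spanningSets_lt_top Λ n).ne (measure_mono fun x hx => ?_)
    by_contra hxn
    simp only [Set.mem_preimage, Set.mem_singleton_iff, hFapp, Set.indicator_of_notMem hxn] at hx
    exact hc hx.symm
  have hleft : Tendsto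
      (fun n => ∫⁻ ω, negExp (∫⁻ x, F n x ∂pointMeasure (K ω) (fun i => Z i ω)) ∂P) atTop
      (𝓝 (∫⁻ ω, negExp (∫⁻ x, f x ∂pointMeasure (K ω) (fun i => Z i ω)) ∂P)) := by
    refine tendsto_lintegral_of_dominated_convergence (fun _ => 1)
      (fun n => measurable_negExp.comp (measurable_lintegral_pointMeasure hZ.measurable_number
        hZ.measurable_point (F n).measurable)) (fun n => ae_of_all _ fun ω => negExp_le_one _)
      (by simp) (ae_of_all _ fun ω => (continuous_negExp.tendsto _).comp ?_)
    exact lintegral_tendsto_of_tendsto_of_monotone (fun n => (F n).measurable.aemeasurable)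
      (ae_of_all _ hFmono) (ae_of_all _ hFlim)
  have hright : Tendsto (fun n => negExp (∫⁻ x, (1 - negExp (F n x)) ∂Λ)) atTop
      (𝓝 (negExp (∫⁻ x, (1 - negExp (f x)) ∂Λ))) := by
    refine (continuous_negExp.tendsto _).comp (lintegral_tendsto_of_tendsto_of_monotone
      (fun n => (measurable_const.sub (measurable_negExp.comp (F n).measurable)).aemeasurable)
      (ae_of_all _ fun x m n hmn => tsub_le_tsub_left (antitone_negExp (hFmono x hmn)) 1)
      (ae_of_all _ fun x => ?_))
    exact ENNReal.Tendsto.sub tendsto_const_nhds ((continuous_negExp.tendsto _).comp (hFlim x))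
      (Or.inl ENNReal.one_ne_top)
  refine tendsto_nhds_unique hleft (hright.congr fun n => ?_)
  exact (hZ.lintegral_negExp_simpleFunc (F n) (hFin n)).symm

end IsPoissonPointProcess

end PointMeasure

/-! ### Product laws and averaging over the fading -/

lemma map_infinitePi_option_eq_prod {ι X : Type*} [MeasurableSpace X] (ν : Measure X)
    [IsProbabilityMeasure ν] :
    (Measure.infinitePi fun _ : Option ι => ν).map (fun x => (x none, fun i => x (some i))) =
      ν.prod (Measure.infinitePi fun _ : ι => ν) := by
  classical
  let e : X × (ι → X) → Option ι → X := fun p o => o.elim p.1 p.2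
  have he : Measurable e := measurable_pi_iff.2 fun o => by
    cases o <;> simp only [e, Option.elim] <;> fun_prop
  have hpi : (ν.prod (Measure.infinitePi fun _ : ι => ν)).map e =
      Measure.infinitePi fun _ : Option ι => ν := by
    refine Measure.eq_infinitePi _ fun s t ht => ?_
    let t' : Option ι → Set X := fun o => if o ∈ s then t o else Set.univ
    have ht' (o : Option ι) : MeasurableSet (t' o) := by
      by_cases h : o ∈ s <;> simp [t', h, ht]
    have hpre : e ⁻¹' (Set.pi s t) =
        t' none ×ˢ Set.pi (Finset.eraseNone s) (fun i => t' (some i)) := by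
      ext p
      simp only [Set.mem_preimage, Set.mem_pi, Finset.mem_coe, Option.forall, Set.mem_prod,
        Finset.mem_eraseNone, e, t']
      refine and_congr ?_ (forall_congr' fun i => ?_)
      · by_cases h : none ∈ s <;> simp [h]
      · by_cases h : some i ∈ s <;> simp [h]
    have hsub : s ⊆ Finset.insertNone (Finset.eraseNone s) := fun o ho => by
      cases o <;> simp [ho]
    rw [Measure.map_apply he (.pi s.countable_toSet fun o _ => ht o), hpre, Measure.prod_prod,
      Measure.infinitePi_pi _ (fun i _ => ht' (some i)),
      ← Finset.prod_insertNone (fun o => ν (t' o)),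
      ← Finset.prod_subset hsub fun o _ ho => by simp [t', ho]]
    exact Finset.prod_congr rfl fun o ho => by simp [t', ho]
  rw [← hpi, Measure.map_map (by fun_prop) he]
  exact Measure.map_id

lemma lintegral_comp_of_indepFun {Ω X Y : Type*} [MeasurableSpace Ω] [MeasurableSpace X]
    [MeasurableSpace Y] {P : Measure Ω} [IsProbabilityMeasure P] {x : Ω → X} {y : Ω → Y}
    (hxy : IndepFun x y P) (hx : AEMeasurable x P) (hy : AEMeasurable y P)
    {φ : X × Y → ℝ≥0∞} (hφ : Measurable φ) :
    ∫⁻ ω, φ (x ω, y ω) ∂P = ∫⁻ ω, ∫⁻ v, φ (x ω, v) ∂(P.map y) ∂P := by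
  have := Measure.isProbabilityMeasure_map hy
  rw [← lintegral_map' (f := φ) (g := fun ω => (x ω, y ω)) hφ.aemeasurable (hx.prodMk hy),
    (indepFun_iff_map_prod_eq_prod_map_map hx hy).1 hxy, lintegral_prod _ hφ.aemeasurable,
    lintegral_map' hφ.lintegral_prod_right'.aemeasurable hx]

section Fading

instance : IsProbabilityMeasure (expMeasure 1) := isProbabilityMeasure_expMeasure one_pos

/-- Finite products factor by independence of the coordinates; being bounded by `1`, they pass to
the limit. -/
lemma lintegral_negExp_tsum_infinitePi_expMeasure (c : ℕ → ℝ≥0∞) :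
    ∫⁻ y, negExp (∑' i, ENNReal.ofReal (y i) * c i) ∂(Measure.infinitePi fun _ : ℕ => expMeasure 1)
      = negExp (∑' i, (ENNReal.log (1 + c i)).toENNReal) := by
  have hm (i : ℕ) : Measurable fun x : ℝ => negExp (ENNReal.ofReal x * c i) :=
    measurable_negExp.comp (by fun_prop)
  have hleft : Tendsto (fun n => ∫⁻ y, ∏ i ∈ Finset.range n, negExp (ENNReal.ofReal (y i) * c i)
      ∂(Measure.infinitePi fun _ : ℕ => expMeasure 1)) atTop
      (𝓝 (∫⁻ y, negExp (∑' i, ENNReal.ofReal (y i) * c i)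
        ∂(Measure.infinitePi fun _ : ℕ => expMeasure 1))) :=
    tendsto_lintegral_of_dominated_convergence (fun _ => 1)
      (fun n => Finset.measurable_prod _ fun i _ => (hm i).comp (measurable_pi_apply i))
      (fun n => ae_of_all _ fun y => Finset.prod_le_one' fun i _ => negExp_le_one _)
      (by simp) (ae_of_all _ fun y => tendsto_negExp_tsum _)
  refine tendsto_nhds_unique hleft ((tendsto_negExp_tsum _).congr fun n => ?_)
  rw [lintegral_prod_eq_prod_lintegral_of_indepFun _
    (fun i (y : ℕ → ℝ) => negExp (ENNReal.ofReal (y i) * c i)) (iIndepFun_infinitePi hm)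
    (fun i => (hm i).comp (measurable_pi_apply i))]
  refine Finset.prod_congr rfl fun i _ => ?_
  rw [(measurePreserving_eval_infinitePi (fun _ : ℕ => expMeasure 1) i).lintegral_comp (hm i),
    lintegral_expMeasure_negExp_mul, negExp_toENNReal_log le_self_add]

lemma lintegral_negExp_tsum_lt_infinitePi_expMeasure (k : ℕ∞) (c : ℕ → ℝ≥0∞) :
    ∫⁻ y, negExp (∑' i : {i : ℕ // (i : ℕ∞) < k}, ENNReal.ofReal (y i) * c i)
        ∂(Measure.infinitePi fun _ : ℕ => expMeasure 1)
      = negExp (∑' i : {i : ℕ // (i : ℕ∞) < k}, (ENNReal.log (1 + c i)).toENNReal) := by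
  -- Indices that are not points get `c = 0`, which contributes `log 1 = 0`.
  have h := lintegral_negExp_tsum_infinitePi_expMeasure (fun i => if (i : ℕ∞) < k then c i else 0)
  simp_rw [fun y : ℕ → ℝ => tsum_lt_eq_tsum_ite k (fun i => ENNReal.ofReal (y i) * c i),
    tsum_lt_eq_tsum_ite k (fun i => (ENNReal.log (1 + c i)).toENNReal)]
  convert h using 5 with y
  · ext i
    split_ifs <;> simp
  · split_ifs <;> simp

end Fading

/-! ### The SINR event and the interference -/

/-- Since `θ` is neither `0` nor `∞`, the denominator can be cleared even when it is `0` or `∞`. -/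
lemma sinr_le_iff {Ω : Type*} {ρ α : ℝ} {g : Ω → ℝ} {δ : D2DMode} {R σ β θ : ℝ} (hρ : 0 < ρ) (hR : 0 < R) (hθ : 0 < θ)
    (I : Ω → ℝ≥0∞) (ω : Ω) :
    sinr δ ρ α R σ β g I ω ≤ ENNReal.ofReal θ ↔
      ENNReal.ofReal (g ω) ≤ ENNReal.ofReal (θ * R ^ α / ρ) *
        (ENNReal.ofReal (σ ^ 2) + I ω + ENNReal.ofReal (δ.indicator * (β * ρ))) := by
  have hRα : 0 < R ^ α := by positivity
  have hk : 0 < ρ / R ^ α := by positivity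
  have h1 : ρ * g ω * R ^ (-α) = ρ / R ^ α * g ω := by
    rw [Real.rpow_neg hR.le]; ring
  have h2 : θ = ρ / R ^ α * (θ * R ^ α / ρ) := by field_simp
  rw [sinr, ENNReal.div_le_iff_le_mul (Or.inr ENNReal.ofReal_ne_top)
    (Or.inr (ENNReal.ofReal_pos.2 hθ).ne'), h1, ENNReal.ofReal_mul hk.le]
  nth_rewrite 1 [h2]
  rw [ENNReal.ofReal_mul hk.le, mul_assoc, ENNReal.mul_le_mul_iff_right
    (ENNReal.ofReal_pos.2 hk).ne' ENNReal.ofReal_ne_top]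

section Interference

variable {Ω : Type*} [MeasurableSpace Ω] {P : Measure Ω} [IsProbabilityMeasure P]
  {ρ α : ℝ} {K : Ω → ℕ∞} {Z : ℕ → Ω → Plane} {g : Ω → ℝ} {h : ℕ → Ω → ℝ}

/-- The interference as a function of the points and of the fading gains. -/
noncomputable def interferenceOf (ρ α : ℝ) (q : (ℕ∞ × (ℕ → Plane)) × (ℕ → ℝ)) : ℝ≥0∞ :=
  ∑' i : {i : ℕ // (i : ℕ∞) < q.1.1}, ENNReal.ofReal (ρ * q.2 i) * ‖q.1.2 i‖ₑ ^ (-α)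

lemma measurable_interferenceOf : Measurable (interferenceOf ρ α) :=
  measurable_tsum_lt (g := fun i (q : (ℕ∞ × (ℕ → Plane)) × (ℕ → ℝ)) =>
    ENNReal.ofReal (ρ * q.2 i) * ‖q.1.2 i‖ₑ ^ (-α)) (K := fun q => q.1.1)
    (fun i => by fun_prop) (by fun_prop)

lemma lintegral_negExp_mul_interference {c s : ℝ} (hc : 0 ≤ c) (hα : 2 < α) (hρ : 0 ≤ ρ)
    (hs : 0 ≤ s) (hZ : IsPoissonPointProcess P K Z (ENNReal.ofReal c • volume))
    (hh : HasLaw (fun ω i => h i ω) (Measure.infinitePi fun _ : ℕ => expMeasure 1) P)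
    (hZh : IndepFun (fun ω => (K ω, fun i => Z i ω)) (fun ω i => h i ω) P) :
    ∫⁻ ω, negExp (ENNReal.ofReal s * interference ρ α K Z h ω) ∂P =
      ENNReal.ofReal (Real.exp (-(2 * Real.pi ^ 2 / α) * c * (s * ρ) ^ (2 / α) *
        (1 / Real.sin (2 / α * Real.pi)))) := by
  have hX : Measurable fun ω => (K ω, fun i => Z i ω) :=
    hZ.measurable_number.prodMk (measurable_pi_iff.2 hZ.measurable_point)
  -- Chosen so that `negExp (f z)` is the averaged fading factor of a point at `z`.
  let f : Plane → ℝ≥0∞ :=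
    fun z => (ENNReal.log (1 + ENNReal.ofReal (s * ρ) * ‖z‖ₑ ^ (-α))).toENNReal
  have hf : Measurable f := by fun_prop
  have hsin : 0 < Real.sin (2 / α * Real.pi) := by
    have : 2 / α < 1 := by rw [div_lt_one (by linarith)]; exact hα
    refine Real.sin_pos_of_pos_of_lt_pi (by positivity) ?_
    nlinarith [Real.pi_pos]
  have hfade (ω : Ω) : ∫⁻ y, negExp (ENNReal.ofReal s *
      interferenceOf ρ α ((K ω, fun i => Z i ω), y)) ∂(P.map fun ω i => h i ω) =
      negExp (∫⁻ z, f z ∂pointMeasure (K ω) (fun i => Z i ω)) := by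
    rw [hh.map_eq, lintegral_pointMeasure _ _ hf,
      ← lintegral_negExp_tsum_lt_infinitePi_expMeasure (K ω)
        (fun i => ENNReal.ofReal (s * ρ) * ‖Z i ω‖ₑ ^ (-α))]
    refine lintegral_congr fun y => ?_
    rw [interferenceOf, ← ENNReal.tsum_mul_left]
    congr 1
    refine tsum_congr fun i => ?_
    rw [ENNReal.ofReal_mul hρ, ENNReal.ofReal_mul hs]
    ring
  have hcond := lintegral_comp_of_indepFun hZh hX.aemeasurable hh.aemeasurable
    (φ := fun q => negExp (ENNReal.ofReal s * interferenceOf ρ α q))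
    (measurable_negExp.comp (measurable_interferenceOf.const_mul _))
  have hnn : 0 ≤ 2 * Real.pi ^ 2 / α * (s * ρ) ^ (2 / α) * (1 / Real.sin (2 / α * Real.pi)) := by
    have : 0 < α := by linarith
    positivity
  refine hcond.trans ?_
  simp_rw [hfade]
  have : SigmaFinite (ENNReal.ofReal c • (volume : Measure Plane)) :=
    inferInstanceAs (SigmaFinite (c.toNNReal • (volume : Measure Plane)))
  rw [hZ.lintegral_negExp_lintegral hf, lintegral_smul_measure]
  simp_rw [f, fun z : Plane => negExp_toENNReal_log
    (le_self_add : 1 ≤ 1 + ENNReal.ofReal (s * ρ) * ‖z‖ₑ ^ (-α))]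
  rw [lintegral_one_sub_inv_one_add_pathloss (by positivity) hα, smul_eq_mul,
    ← ENNReal.ofReal_mul hc, negExp_ofReal (mul_nonneg hc hnn)]
  ring_nf

/-- Where `X = ∞` the integrand is `0`, so each integral is at most `P {X < ∞}`. -/
lemma ae_lt_top_of_tendsto_lintegral_negExp {X : Ω → ℝ≥0∞} (hX : AEMeasurable X P)
    {s : ℕ → ℝ≥0∞} (hs : ∀ n, s n ≠ 0)
    (hlim : Tendsto (fun n => ∫⁻ ω, negExp (s n * X ω) ∂P) atTop (𝓝 1)) :
    ∀ᵐ ω ∂P, X ω < ∞ := by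
  have h1 : 1 ≤ P {ω | X ω < ∞} := by
    refine le_of_tendsto hlim (Eventually.of_forall fun n => ?_)
    refine (lintegral_mono fun ω => ?_).trans (lintegral_indicator_one_le {ω | X ω < ∞})
    by_cases hω : X ω < ∞
    · simpa [hω] using negExp_le_one _
    · simp [not_lt_top_iff.1 hω, ENNReal.mul_top (hs n)]
  exact (prob_compl_eq_zero_iff₀ (nullMeasurableSet_lt hX aemeasurable_const)).2
    (le_antisymm prob_le_one h1)

/-- Finiteness matters because `toReal` sends `∞` to `0`, which would turn `exp (-∞)` into `1`. -/
lemma laplaceTransform_eq_toReal_lintegral {P : Measure Ω} {X : Ω → ℝ≥0∞} (hX : AEMeasurable X P) (hfin : ∀ᵐ ω ∂P, X ω < ∞)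
    {s : ℝ} (hs : 0 ≤ s) :
    laplaceTransform P X s = (∫⁻ ω, negExp (ENNReal.ofReal s * X ω) ∂P).toReal := by
  rw [laplaceTransform, integral_eq_lintegral_of_nonneg_ae
    (ae_of_all _ fun ω => (Real.exp_pos _).le)
    (Real.measurable_exp.comp_aemeasurable (hX.ennreal_toReal.const_mul (-s))).aestronglyMeasurable]
  congr 1
  refine lintegral_congr_ae ?_
  filter_upwards [hfin] with ω hω
  rw [negExp_of_ne_top (ENNReal.mul_ne_top ENNReal.ofReal_ne_top hω.ne), ENNReal.toReal_mul,
    ENNReal.toReal_ofReal hs, neg_mul]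

/-- With the points and interfering gains frozen, `g` is still exponential, so its tail at the
threshold is `negExp`. -/
lemma measure_setOf_lt_ofReal_interference
    (hZ : AEMeasurable (fun ω => (K ω, fun i => Z i ω)) P)
    (hgh : HasLaw (fun ω => (g ω, fun i => h i ω))
      ((expMeasure 1).prod (Measure.infinitePi fun _ : ℕ => expMeasure 1)) P)
    (hind : IndepFun (fun ω => (K ω, fun i => Z i ω)) (fun ω => (g ω, fun i => h i ω)) P)
    {T : ℝ≥0∞ → ℝ≥0∞} (hT : Measurable T) :
    P {ω | T (interference ρ α K Z h ω) < ENNReal.ofReal (g ω)} =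
      ∫⁻ ω, negExp (T (interference ρ α K Z h ω)) ∂P := by
  have hh : HasLaw (fun ω i => h i ω) (Measure.infinitePi fun _ : ℕ => expMeasure 1) P := by
    refine ⟨hgh.aemeasurable.snd, ?_⟩
    have := AEMeasurable.map_map_of_aemeasurable (μ := P) measurable_snd.aemeasurable
      hgh.aemeasurable
    rw [hgh.map_eq, Measure.map_snd_prod] at this
    simpa [Function.comp_def] using this.symm
  have hTI : Measurable fun q => T (interferenceOf ρ α q) := hT.comp measurable_interferenceOf
  have hset : MeasurableSet {q : (ℕ∞ × (ℕ → Plane)) × ℝ × (ℕ → ℝ) |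
      T (interferenceOf ρ α (q.1, q.2.2)) < ENNReal.ofReal q.2.1} :=
    measurableSet_lt (hTI.comp (by fun_prop)) (by fun_prop)
  have h1 := lintegral_comp_of_indepFun hind hZ hgh.aemeasurable (measurable_one.indicator hset)
  have hindh : IndepFun (fun ω => (K ω, fun i => Z i ω)) (fun ω i => h i ω) P :=
    hind.comp measurable_id measurable_snd
  have h2 := lintegral_comp_of_indepFun hindh hZ hh.aemeasurable
    (measurable_negExp.comp hTI)
  have hnull : NullMeasurableSet {ω | T (interference ρ α K Z h ω) < ENNReal.ofReal (g ω)} P :=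
    (hZ.prodMk hgh.aemeasurable).nullMeasurableSet_preimage hset
  rw [← lintegral_indicator_one₀ hnull]
  refine (h1.trans (lintegral_congr fun ω => ?_)).trans h2.symm
  rw [hgh.map_eq, hh.map_eq]
  refine (lintegral_prod_symm _ ((measurable_one.indicator hset).comp
    measurable_prodMk_left).aemeasurable).trans (lintegral_congr fun y => ?_)
  simp only [Function.comp_apply]
  rw [← expMeasure_setOf_lt_ofReal, ← lintegral_indicator_one
    (measurableSet_lt measurable_const (by fun_prop))]
  rfl

end Interference

/-! ### The outage theorem -/

theorem theorem1 {Ω : Type*} [MeasurableSpace Ω] (P : Measure Ω) [IsProbabilityMeasure P]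
    (δ : D2DMode)
    -- density of the users, fraction of demanding users, probability of each mode
    (lam μ : ℝ) (p : D2DMode → ℝ)
    (hlam : 0 ≤ lam) (hμ : μ ∈ Set.Icc (0 : ℝ) 1) (hp : ∀ d, p d ∈ Set.Icc (0 : ℝ) 1)
    -- transmit power, path-loss exponent, link length, noise, self-interference, threshold
    (ρ α R σ β θ : ℝ)
    (hρ : 0 < ρ) (hα : 2 < α) (hR : 0 < R) (hβ : β ∈ Set.Icc (0 : ℝ) 1) (hθ : 0 < θ)
    -- the interferers form a homogeneous Poisson point process of intensity `μ * p δ * lam`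
    (K : Ω → ℕ∞) (Z : ℕ → Ω → Plane)
    (hZ : IsPoissonPointProcess P K Z (ENNReal.ofReal (μ * p δ * lam) • volume))
    -- independent unit-mean Rayleigh fading: `g` on the desired link, `h i` on the interfering ones
    (g : Ω → ℝ) (h : ℕ → Ω → ℝ)
    (hg_law : HasLaw g (expMeasure 1) P) (hh_law : ∀ i, HasLaw (h i) (expMeasure 1) P)
    (h_indep : iIndepFun (fun o : Option ℕ => o.elim g h) P)
    (hZ_indep : IndepFun (fun ω => (K ω, fun i => Z i ω)) (fun ω => (g ω, fun i => h i ω)) P) :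
    (∀ᵐ ω ∂P, interference ρ α K Z h ω < ∞) ∧
    P.real {ω | sinr δ ρ α R σ β g (interference ρ α K Z h) ω ≤ ENNReal.ofReal θ} =
      1 - Real.exp (-θ * R ^ α * (σ ^ 2 + δ.indicator * (β * ρ)) / ρ) *
        laplaceTransform P (interference ρ α K Z h) (θ * R ^ α / ρ) ∧
    ∀ s : ℝ, 0 ≤ s → laplaceTransform P (interference ρ α K Z h) s =
      Real.exp (-(2 * Real.pi ^ 2 / α) * (μ * p δ * lam) * (s * ρ) ^ (2 / α) *
        (1 / Real.sin (2 / α * Real.pi))) := by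
  have hgh : HasLaw (fun ω => (g ω, fun i => h i ω))
      ((expMeasure 1).prod (Measure.infinitePi fun _ : ℕ => expMeasure 1)) P := by
    have hlaw := h_indep.hasLaw_infinitePi (μ := fun _ => expMeasure 1)
      (by rintro (_ | i); exacts [hg_law, hh_law i])
      (aemeasurable_pi_iff.2 (by
        rintro (_ | i); exacts [hg_law.aemeasurable, (hh_law i).aemeasurable]))
    refine ⟨hg_law.aemeasurable.prodMk (aemeasurable_pi_iff.2 fun i => (hh_law i).aemeasurable), ?_⟩
    rw [← map_infinitePi_option_eq_prod, ← hlaw.map_eq,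
      AEMeasurable.map_map_of_aemeasurable (by fun_prop) hlaw.aemeasurable]
    rfl
  have hh : HasLaw (fun ω i => h i ω) (Measure.infinitePi fun _ : ℕ => expMeasure 1) P :=
    (h_indep.precomp (Option.some_injective ℕ)).hasLaw_infinitePi hh_law
      (aemeasurable_pi_iff.2 fun i => (hh_law i).aemeasurable)
  have hX : AEMeasurable (fun ω => (K ω, fun i => Z i ω)) P :=
    (hZ.measurable_number.prodMk (measurable_pi_iff.2 hZ.measurable_point)).aemeasurable
  have hI : AEMeasurable (interference ρ α K Z h) P :=
    measurable_interferenceOf.comp_aemeasurable (hX.prodMk hh.aemeasurable)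
  have hc : 0 ≤ μ * p δ * lam := mul_nonneg (mul_nonneg hμ.1 (hp δ).1) hlam
  have hlap (s : ℝ) (hs : 0 ≤ s) := lintegral_negExp_mul_interference hc hα hρ.le hs hZ hh
    (hZ_indep.comp measurable_id measurable_snd)
  have hfin : ∀ᵐ ω ∂P, interference ρ α K Z h ω < ∞ := by
    refine ae_lt_top_of_tendsto_lintegral_negExp hI
      (s := fun n : ℕ => ENNReal.ofReal (1 / ((n : ℝ) + 1)))
      (fun n => (ENNReal.ofReal_pos.2 (by positivity)).ne') ?_
    simp_rw [fun n : ℕ => hlap (1 / ((n : ℝ) + 1)) (by positivity)]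
    -- Positivity of `2 / α` makes the transform continuous at `s = 0` with value `1`.
    have h2 : 0 < 2 / α := by positivity
    have hcont : Continuous fun s : ℝ => ENNReal.ofReal (Real.exp (-(2 * Real.pi ^ 2 / α) *
        (μ * p δ * lam) * (s * ρ) ^ (2 / α) * (1 / Real.sin (2 / α * Real.pi)))) := by
      have := Real.continuous_rpow_const h2.le
      exact ENNReal.continuous_ofReal.comp (by fun_prop)
    have h0 := (hcont.tendsto 0).comp tendsto_one_div_add_atTop_nhds_zero_nat
    simpa [Real.zero_rpow h2.ne', Function.comp_def] using h0
  refine ⟨hfin, ?_, fun s hs => ?_⟩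
  · set s := θ * R ^ α / ρ with hs_def
    have hs : 0 ≤ s := by positivity
    have hd : 0 ≤ δ.indicator * (β * ρ) :=
      mul_nonneg (by cases δ <;> simp [D2DMode.indicator]) (mul_nonneg hβ.1 hρ.le)
    -- The level that `g` must exceed for success, given interference `x`.
    let T : ℝ≥0∞ → ℝ≥0∞ := fun x => ENNReal.ofReal s *
      (ENNReal.ofReal (σ ^ 2) + x + ENNReal.ofReal (δ.indicator * (β * ρ)))
    have hT : Measurable T := by fun_prop
    have hcompl : {ω | sinr δ ρ α R σ β g (interference ρ α K Z h) ω ≤ ENNReal.ofReal θ} =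
        {ω | T (interference ρ α K Z h ω) < ENNReal.ofReal (g ω)}ᶜ := by
      ext ω
      simp only [Set.mem_ofPred_eq, Set.mem_compl_iff, not_lt]
      exact sinr_le_iff hρ hR hθ _ ω
    have hTexp (x : ℝ≥0∞) : negExp (T x) = ENNReal.ofReal (Real.exp (-θ * R ^ α *
        (σ ^ 2 + δ.indicator * (β * ρ)) / ρ)) * negExp (ENNReal.ofReal s * x) := by
      have : T x = ENNReal.ofReal (s * (σ ^ 2 + δ.indicator * (β * ρ))) + ENNReal.ofReal s * x := by
        rw [ENNReal.ofReal_mul hs, ENNReal.ofReal_add (sq_nonneg σ) hd]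
        ring
      rw [this, negExp_add, negExp_ofReal (by positivity), hs_def]
      ring_nf
    have hnull : NullMeasurableSet
        {ω | T (interference ρ α K Z h ω) < ENNReal.ofReal (g ω)} P :=
      nullMeasurableSet_lt (hT.comp_aemeasurable hI) hg_law.aemeasurable.ennreal_ofReal
    rw [hcompl, probReal_compl_eq_one_sub₀ hnull, measureReal_def,
      measure_setOf_lt_ofReal_interference hX hgh hZ_indep hT]
    simp_rw [hTexp]
    rw [lintegral_const_mul' _ _ ENNReal.ofReal_ne_top, ENNReal.toReal_mul,
      ENNReal.toReal_ofReal (Real.exp_pos _).le, ← laplaceTransform_eq_toReal_lintegral hI hfin hs]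
  · rw [laplaceTransform_eq_toReal_lintegral hI hfin hs, hlap s hs,
      ENNReal.toReal_ofReal (Real.exp_pos _).le]
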